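/- Let $\mathcal L$ be a set of letters. Formulae are built from letters with binary connectives $\times$ and $+$. Typed arrow terms $f:A\to B$ between formulae are built from identities $\mathbf 1_A$ by composition $g\circ f$ and the operations: from $f:A\to C$, $K^1_Bf:A\times B\to C$; from $f:B\to C$, $K^2_Af:A\times B\to C$; from $f:C\to A$, $g:C\to B$, $\langle f,g\rangle:C\to A\times B$; and dually $L^1_Bf:C\to A+B$ (from $f:C\to A$), $L^2_Af:C\to A+B$ (from $f:C\to B$), $[f,g]:A+B\to C$ (from $f:A\to C$, $g:B\to C$). Put $k^1_{A,B}=K^1_B\mathbf 1_A$, $k^2_{A,B}=K^2_A\mathbf 1_B$, $l^1_{A,B}=L^1_B\mathbf 1_A$, $l^2_{A,B}=L^2_A\mathbf 1_B$. The free category $\mathcal C_{\times,+}$ with binary products and sums generated by $\mathcal L$ has the formulae as objects and, as arrows, the terms modulo the least congruence satisfying the category equations and, for $i\in\{1,2\}$, $$g\circ K^i_Af=K^i_A(g\circ f),\quad K^i_Ag\circ\langle f_1,f_2\rangle=g\circ f_i,\quad \langle g_1,g_2\rangle\circ f=\langle g_1\circ f,g_2\circ f\rangle,\quad \langle k^1_{A,B},k^2_{A,B}\rangle=\mathbf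 1_{A\times B},$$ $$L^i_Ag\circ f=L^i_A(g\circ f),\quad [g_1,g_2]\circ L^i_Af=g_i\circ f,\quad g\circ[f_1,f_2]=[g\circ f_1,g\circ f_2],\quad [l^1_{A,B},l^2_{A,B}]=\mathbf 1_{A+B}.$$ Given a category $\mathcal B$ with (chosen) binary products and sums and an assignment of objects of $\mathcal B$ to the letters, every formula denotes an object of $\mathcal B$ and every term an arrow of $\mathcal B$ in the evident way ($K^i$ is precomposition with the $i$-th projection, $L^i$ is postcomposition with the $i$-th injection, $\langle\,,\rangle$ and $[\,,]$ are pairing and copairing). An equation $f=g$ between terms of the same type holds in $\mathcal B$ if $f$ and $g$ denote the same arrow for every assignment. Theorem. Let $f,g:A\to B$ be terms such that $f=g$ does not hold in $\mathcal C_{\times,+}$, i.e. $f$ and $g$ represent different arrows of $\mathcal C_{\times,+}$. (1) If $\mathcal B$ is a category with binary products and sums in which $f=g$ holds, then $\mathcal B$ is a preorder, i.e. any two arrows of $\mathcal B$ with the same source and the same target are equal. (2) For every letter $p$, at least one of the equations $k^1_{p,p}=k^2_{p,p}$ and $l^1_{p,p}=l^2_{p,p}$ is derivable from $f=g$, that is,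 it belongs to the least congruence on terms satisfying the above equations and containing all equations obtained from $f=g$ by uniformly substituting formulae for letters. -/

import Mathlib

open CategoryTheory CategoryTheory.Limits

universe w v u

/- Makes `X ⟶ Y` elaborate through `CategoryStruct.toQuiver`, as in Mathlib's lemmas, and not
through the (definitionally equal) underlying reflexive quiver. -/
attribute [-instance] CategoryTheory.catToReflQuiver

namespace ProdSum

/-- Formulae built from propositional letters in `L` with the binary connectives `×` and `+`. -/
inductive Formula (L : Type w) : Type w
  | letter (p : L) : Formula L
  | prod (A B : Formula L) : Formula L
  | sum (A B : Formula L) : Formula L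

/-- Arrow terms of the language of categories with binary products and sums.
`K₁ B f` is `K¹_B f`, `K₂ A f` is `K²_A f`, and similarly for `L₁`, `L₂`;
`pair f g` is `⟨f, g⟩` and `copair f g` is `[f, g]`; `comp g f` is `g ∘ f`. -/
inductive Term {L : Type w} : Formula L → Formula L → Type w
  | id (A : Formula L) : Term A A
  | comp {A B C : Formula L} (g : Term B C) (f : Term A B) : Term A C
  | K₁ {A C : Formula L} (B : Formula L) (f : Term A C) : Term (A.prod B) C
  | K₂ {B C : Formula L} (A : Formula L) (f : Term B C) : Term (A.prod B) C
  | pair {A B C : Formula L} (f : Term C A) (g : Term C B) : Term C (A.prod B)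
  | L₁ {A C : Formula L} (B : Formula L) (f : Term C A) : Term C (A.sum B)
  | L₂ {B C : Formula L} (A : Formula L) (f : Term C B) : Term C (A.sum B)
  | copair {A B C : Formula L} (f : Term A C) (g : Term B C) : Term (A.sum B) C

namespace Term

/-- The projection `k¹_{A,B} : A × B → A`. -/
def k₁ {L : Type w} (A B : Formula L) : Term (A.prod B) A := K₁ B (id A)

/-- The projection `k²_{A,B} : A × B → B`. -/
def k₂ {L : Type w} (A B : Formula L) : Term (A.prod B) B := K₂ A (id B)

/-- The injection `l¹_{A,B} : A → A + B`. -/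
def l₁ {L : Type w} (A B : Formula L) : Term A (A.sum B) := L₁ B (id A)

/-- The injection `l²_{A,B} : B → A + B`. -/
def l₂ {L : Type w} (A B : Formula L) : Term B (A.sum B) := L₂ A (id B)

end Term

/-- Derivability of an equation between parallel terms from the equations of categories with
binary products and sums together with the additional equations `E`. -/
inductive Derives {L : Type w} (E : ∀ ⦃A B : Formula L⦄, Term A B → Term A B → Prop) :
    ∀ {A B : Formula L}, Term A B → Term A B → Prop
  | extra {A B : Formula L} {f g : Term A B} : E f g → Derives E f g
  -- equality is an equivalence relation
  | refl {A B : Formula L} (f : Term A B) : Derives E f f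
  | symm {A B : Formula L} {f g : Term A B} : Derives E f g → Derives E g f
  | trans {A B : Formula L} {f g h : Term A B} : Derives E f g → Derives E g h → Derives E f h
  -- equality is a congruence for the operations on terms
  | comp_congr {A B C : Formula L} {g g' : Term B C} {f f' : Term A B} :
      Derives E g g' → Derives E f f' → Derives E (g.comp f) (g'.comp f')
  | K₁_congr {A B C : Formula L} {f f' : Term A C} :
      Derives E f f' → Derives E (f.K₁ B) (f'.K₁ B)
  | K₂_congr {A B C : Formula L} {f f' : Term B C} :
      Derives E f f' → Derives E (f.K₂ A) (f'.K₂ A)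
  | pair_congr {A B C : Formula L} {f f' : Term C A} {g g' : Term C B} :
      Derives E f f' → Derives E g g' → Derives E (f.pair g) (f'.pair g')
  | L₁_congr {A B C : Formula L} {f f' : Term C A} :
      Derives E f f' → Derives E (f.L₁ B) (f'.L₁ B)
  | L₂_congr {A B C : Formula L} {f f' : Term C B} :
      Derives E f f' → Derives E (f.L₂ A) (f'.L₂ A)
  | copair_congr {A B C : Formula L} {f f' : Term A C} {g g' : Term B C} :
      Derives E f f' → Derives E g g' → Derives E (f.copair g) (f'.copair g')
  -- categorial equations
  | id_comp {A B : Formula L} (f : Term A B) : Derives E ((Term.id B).comp f) f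
  | comp_id {A B : Formula L} (f : Term A B) : Derives E (f.comp (Term.id A)) f
  | assoc {A B C D : Formula L} (h : Term C D) (g : Term B C) (f : Term A B) :
      Derives E (h.comp (g.comp f)) ((h.comp g).comp f)
  -- equations of binary products
  | comp_K₁ {A B C D : Formula L} (g : Term C D) (f : Term A C) :
      Derives E (g.comp (f.K₁ B)) ((g.comp f).K₁ B)
  | comp_K₂ {A B C D : Formula L} (g : Term C D) (f : Term B C) :
      Derives E (g.comp (f.K₂ A)) ((g.comp f).K₂ A)
  | K₁_pair {A B C D : Formula L} (g : Term A D) (f₁ : Term C A) (f₂ : Term C B) :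
      Derives E ((g.K₁ B).comp (f₁.pair f₂)) (g.comp f₁)
  | K₂_pair {A B C D : Formula L} (g : Term B D) (f₁ : Term C A) (f₂ : Term C B) :
      Derives E ((g.K₂ A).comp (f₁.pair f₂)) (g.comp f₂)
  | pair_comp {A B C D : Formula L} (g₁ : Term C A) (g₂ : Term C B) (f : Term D C) :
      Derives E ((g₁.pair g₂).comp f) ((g₁.comp f).pair (g₂.comp f))
  | pair_eta (A B : Formula L) :
      Derives E (((Term.id A).K₁ B).pair ((Term.id B).K₂ A)) (Term.id (A.prod B))
  -- equations of binary sums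
  | L₁_comp {A B C D : Formula L} (g : Term C A) (f : Term D C) :
      Derives E ((g.L₁ B).comp f) ((g.comp f).L₁ B)
  | L₂_comp {A B C D : Formula L} (g : Term C B) (f : Term D C) :
      Derives E ((g.L₂ A).comp f) ((g.comp f).L₂ A)
  | copair_L₁ {A B C D : Formula L} (g₁ : Term A C) (g₂ : Term B C) (f : Term D A) :
      Derives E ((g₁.copair g₂).comp (f.L₁ B)) (g₁.comp f)
  | copair_L₂ {A B C D : Formula L} (g₁ : Term A C) (g₂ : Term B C) (f : Term D B) :
      Derives E ((g₁.copair g₂).comp (f.L₂ A)) (g₂.comp f)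
  | comp_copair {A B C D : Formula L} (g : Term C D) (f₁ : Term A C) (f₂ : Term B C) :
      Derives E (g.comp (f₁.copair f₂)) ((g.comp f₁).copair (g.comp f₂))
  | copair_eta (A B : Formula L) :
      Derives E (((Term.id A).L₁ B).copair ((Term.id B).L₂ A)) (Term.id (A.sum B))

/-- Equality of terms in the free category with binary products and sums:
derivability without additional equations. -/
def freeSetoid {L : Type w} (A B : Formula L) : Setoid (Term A B) where
  r := Derives (fun _ _ _ _ => False)
  iseqv := ⟨Derives.refl, Derives.symm, Derives.trans⟩

/-- The free category with binary products and sums generated by `L`: its objects are the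
formulae, its arrows are equivalence classes of terms. -/
instance freeCategory (L : Type w) : Category.{w} (Formula L) where
  Hom A B := Quotient (freeSetoid A B)
  id A := Quotient.mk (freeSetoid A A) (Term.id A)
  comp {A B C} x y := Quotient.map₂ (sa := freeSetoid A B) (sb := freeSetoid B C)
    (sc := freeSetoid A C) (fun f g => g.comp f)
    (fun _ _ hf _ _ hg => Derives.comp_congr hg hf) x y
  id_comp {A B} x := Quotient.inductionOn (s := freeSetoid A B) x
    fun f => Quotient.sound (s := freeSetoid A B) (Derives.comp_id f)
  comp_id {A B} x := Quotient.inductionOn (s := freeSetoid A B) x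
    fun f => Quotient.sound (s := freeSetoid A B) (Derives.id_comp f)
  assoc {A B C D} x y z := Quotient.inductionOn₃ (s₁ := freeSetoid A B) (s₂ := freeSetoid B C)
    (s₃ := freeSetoid C D) x y z
    fun f g h => Quotient.sound (s := freeSetoid A D) (Derives.assoc h g f)

/-- The arrow of the free category denoted by a term. -/
def Term.arrow {L : Type w} {A B : Formula L} (f : Term A B) : A ⟶ B :=
  Quotient.mk (freeSetoid A B) f

/-- Uniform substitution of formulae for letters in a formula. -/
def Formula.subst {L : Type w} (s : L → Formula L) : Formula L → Formula L
  | letter p => s p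
  | prod A B => (A.subst s).prod (B.subst s)
  | sum A B => (A.subst s).sum (B.subst s)

/-- Uniform substitution of formulae for letters in (the indices of) a term. -/
def Term.subst {L : Type w} (s : L → Formula L) :
    ∀ {A B : Formula L}, Term A B → Term (A.subst s) (B.subst s)
  | _, _, .id A => .id (A.subst s)
  | _, _, .comp g f => .comp (g.subst s) (f.subst s)
  | _, _, .K₁ B f => .K₁ (B.subst s) (f.subst s)
  | _, _, .K₂ A f => .K₂ (A.subst s) (f.subst s)
  | _, _, .pair f g => .pair (f.subst s) (g.subst s)
  | _, _, .L₁ B f => .L₁ (B.subst s) (f.subst s)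
  | _, _, .L₂ A f => .L₂ (A.subst s) (f.subst s)
  | _, _, .copair f g => .copair (f.subst s) (g.subst s)

/-- The substitution instances of the equation `f = g`. -/
inductive Instances {L : Type w} {A B : Formula L} (f g : Term A B) :
    ∀ ⦃A' B' : Formula L⦄, Term A' B' → Term A' B' → Prop
  | mk (s : L → Formula L) : Instances f g (f.subst s) (g.subst s)

section Interpretation

variable {𝓑 : Type u} [Category.{v} 𝓑]

/-- The first projection of the chosen product of `X` and `Y`. -/
def fst (P : ∀ X Y : 𝓑, LimitCone (Limits.pair X Y)) (X Y : 𝓑) : (P X Y).cone.pt ⟶ X :=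
  BinaryFan.fst (P X Y).cone

/-- The second projection of the chosen product of `X` and `Y`. -/
def snd (P : ∀ X Y : 𝓑, LimitCone (Limits.pair X Y)) (X Y : 𝓑) : (P X Y).cone.pt ⟶ Y :=
  BinaryFan.snd (P X Y).cone

/-- Pairing into the chosen product of `X` and `Y`. -/
def lift (P : ∀ X Y : 𝓑, LimitCone (Limits.pair X Y)) {X Y Z : 𝓑} (f : Z ⟶ X) (g : Z ⟶ Y) :
    Z ⟶ (P X Y).cone.pt :=
  (P X Y).isLimit.lift (BinaryFan.mk f g)

/-- The first injection into the chosen sum of `X` and `Y`. -/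
def inl (S : ∀ X Y : 𝓑, ColimitCocone (Limits.pair X Y)) (X Y : 𝓑) : X ⟶ (S X Y).cocone.pt :=
  BinaryCofan.inl (S X Y).cocone

/-- The second injection into the chosen sum of `X` and `Y`. -/
def inr (S : ∀ X Y : 𝓑, ColimitCocone (Limits.pair X Y)) (X Y : 𝓑) : Y ⟶ (S X Y).cocone.pt :=
  BinaryCofan.inr (S X Y).cocone

/-- Copairing out of the chosen sum of `X` and `Y`. -/
def desc (S : ∀ X Y : 𝓑, ColimitCocone (Limits.pair X Y)) {X Y Z : 𝓑} (f : X ⟶ Z) (g : Y ⟶ Z) :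
    (S X Y).cocone.pt ⟶ Z :=
  (S X Y).isColimit.desc (BinaryCofan.mk f g)

/-- The object denoted by a formula in a category with binary products `P` and binary sums `S`,
under an assignment `ρ` of objects to letters. -/
def Formula.interp {L : Type w}
    (P : ∀ X Y : 𝓑, LimitCone (Limits.pair X Y))
    (S : ∀ X Y : 𝓑, ColimitCocone (Limits.pair X Y)) (ρ : L → 𝓑) : Formula L → 𝓑
  | letter p => ρ p
  | prod A B => (P (A.interp P S ρ) (B.interp P S ρ)).cone.pt
  | sum A B => (S (A.interp P S ρ) (B.interp P S ρ)).cocone.pt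

/-- The arrow denoted by a term in a category with binary products `P` and binary sums `S`,
under an assignment `ρ` of objects to letters. -/
def Term.interp {L : Type w}
    (P : ∀ X Y : 𝓑, LimitCone (Limits.pair X Y))
    (S : ∀ X Y : 𝓑, ColimitCocone (Limits.pair X Y)) (ρ : L → 𝓑) :
    ∀ {A B : Formula L}, Term A B → (A.interp P S ρ ⟶ B.interp P S ρ)
  | _, _, .id A => 𝟙 (A.interp P S ρ)
  | _, _, .comp g f => f.interp P S ρ ≫ g.interp P S ρ
  | _, _, .K₁ (A := A) B f => fst P (A.interp P S ρ) (B.interp P S ρ) ≫ f.interp P S ρ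
  | _, _, .K₂ (B := B) A f => snd P (A.interp P S ρ) (B.interp P S ρ) ≫ f.interp P S ρ
  | _, _, .pair f g => lift P (f.interp P S ρ) (g.interp P S ρ)
  | _, _, .L₁ (A := A) B f => f.interp P S ρ ≫ inl S (A.interp P S ρ) (B.interp P S ρ)
  | _, _, .L₂ (B := B) A f => f.interp P S ρ ≫ inr S (A.interp P S ρ) (B.interp P S ρ)
  | _, _, .copair f g => desc S (f.interp P S ρ) (g.interp P S ρ)

/-- The equation `f = g` holds in a category with binary products `P` and binary sums `S`:
it holds for every assignment of objects to letters. -/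
def HoldsIn {L : Type w}
    (P : ∀ X Y : 𝓑, LimitCone (Limits.pair X Y))
    (S : ∀ X Y : 𝓑, ColimitCocone (Limits.pair X Y)) {A B : Formula L} (f g : Term A B) : Prop :=
  ∀ ρ : L → 𝓑, f.interp P S ρ = g.interp P S ρ

end Interpretation

end ProdSum

/-! The idea is to turn any underivable equation into one between two distinct arrows `p × p ⟶ p +
p`, of which the free category has exactly four: a projection followed by an injection. An equation
between two of these, when one of them is `π₁ ≫ ι₁`, collapses the projections (fold `p + p` onto
`p`) or the injections (precompose with the diagonal of `p`). In a category where the projections of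
`Y × Y` agree, parallel arrows into `Y` agree; dually for injections.

To reach such arrows, substitute `p` for every letter and enclose `f : A ⟶ B` between `test` and
`cotest`, which single out an occurrence `x` in `A` and an occurrence `y` in `B`. By definition `f`
links `x` to `y` when the result is `π₁ ≫ ι₁`. It remains to see that links determine the arrow
(`eq_of_linked_iff`): distinct arrows then differ at some pair `(x, y)`, and the enclosing context
is a derivation from the instance of `f = g`.

Coherence rests on composition elimination (`Normal.comp`). Arrows out of a sum or into a product
are determined by their components; any other arrow is an identity of a letter, starts with a
projection or ends with an injection. Which projection or injection can be used is visible in the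
links, because every arrow links something (`exists_linked`) and an arrow with no links at one
factor or summand factors through the other (`exists_eq_π₁_comp` and its variants). Equal links
therefore let both arrows be stripped in the same way. -/

namespace ProdSum

/-! ### Soundness of derivations, and collapse of categories to preorders -/

section Soundness

variable {𝓑 : Type u} [Category.{v} 𝓑]
  (P : ∀ X Y : 𝓑, LimitCone (Limits.pair X Y)) (S : ∀ X Y : 𝓑, ColimitCocone (Limits.pair X Y))

@[simp]
theorem lift_fst {X Y Z : 𝓑} (f : Z ⟶ X) (g : Z ⟶ Y) : lift P f g ≫ fst P X Y = f :=
  (P X Y).isLimit.fac (BinaryFan.mk f g) ⟨WalkingPair.left⟩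

@[simp]
theorem lift_snd {X Y Z : 𝓑} (f : Z ⟶ X) (g : Z ⟶ Y) : lift P f g ≫ snd P X Y = g :=
  (P X Y).isLimit.fac (BinaryFan.mk f g) ⟨WalkingPair.right⟩

@[simp]
theorem lift_fst_assoc {X Y Z W : 𝓑} (f : Z ⟶ X) (g : Z ⟶ Y) (h : X ⟶ W) :
    lift P f g ≫ fst P X Y ≫ h = f ≫ h := by
  rw [← Category.assoc, lift_fst]

@[simp]
theorem lift_snd_assoc {X Y Z W : 𝓑} (f : Z ⟶ X) (g : Z ⟶ Y) (h : Y ⟶ W) :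
    lift P f g ≫ snd P X Y ≫ h = g ≫ h := by
  rw [← Category.assoc, lift_snd]

theorem comp_lift {X Y Z W : 𝓑} (h : W ⟶ Z) (f : Z ⟶ X) (g : Z ⟶ Y) :
    h ≫ lift P f g = lift P (h ≫ f) (h ≫ g) :=
  BinaryFan.IsLimit.hom_ext (P X Y).isLimit
    (show (h ≫ lift P f g) ≫ fst P X Y = lift P (h ≫ f) (h ≫ g) ≫ fst P X Y by simp)
    (show (h ≫ lift P f g) ≫ snd P X Y = lift P (h ≫ f) (h ≫ g) ≫ snd P X Y by simp)

theorem lift_eta (X Y : 𝓑) : lift P (fst P X Y ≫ 𝟙 X) (snd P X Y ≫ 𝟙 Y) = 𝟙 _ :=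
  BinaryFan.IsLimit.hom_ext (P X Y).isLimit
    (show lift P (fst P X Y ≫ 𝟙 X) (snd P X Y ≫ 𝟙 Y) ≫ fst P X Y = 𝟙 _ ≫ fst P X Y by simp)
    (show lift P (fst P X Y ≫ 𝟙 X) (snd P X Y ≫ 𝟙 Y) ≫ snd P X Y = 𝟙 _ ≫ snd P X Y by simp)

@[simp]
theorem inl_desc {X Y Z : 𝓑} (f : X ⟶ Z) (g : Y ⟶ Z) : inl S X Y ≫ desc S f g = f :=
  (S X Y).isColimit.fac (BinaryCofan.mk f g) ⟨WalkingPair.left⟩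

@[simp]
theorem inr_desc {X Y Z : 𝓑} (f : X ⟶ Z) (g : Y ⟶ Z) : inr S X Y ≫ desc S f g = g :=
  (S X Y).isColimit.fac (BinaryCofan.mk f g) ⟨WalkingPair.right⟩

theorem desc_comp {X Y Z W : 𝓑} (f : X ⟶ Z) (g : Y ⟶ Z) (h : Z ⟶ W) :
    desc S f g ≫ h = desc S (f ≫ h) (g ≫ h) :=
  BinaryCofan.IsColimit.hom_ext (S X Y).isColimit
    (show inl S X Y ≫ desc S f g ≫ h = inl S X Y ≫ desc S (f ≫ h) (g ≫ h) by
      rw [← Category.assoc, inl_desc, inl_desc])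
    (show inr S X Y ≫ desc S f g ≫ h = inr S X Y ≫ desc S (f ≫ h) (g ≫ h) by
      rw [← Category.assoc, inr_desc, inr_desc])

theorem desc_eta (X Y : 𝓑) : desc S (𝟙 X ≫ inl S X Y) (𝟙 Y ≫ inr S X Y) = 𝟙 _ :=
  BinaryCofan.IsColimit.hom_ext (S X Y).isColimit
    (show inl S X Y ≫ desc S (𝟙 X ≫ inl S X Y) (𝟙 Y ≫ inr S X Y) = inl S X Y ≫ 𝟙 _ by simp)
    (show inr S X Y ≫ desc S (𝟙 X ≫ inl S X Y) (𝟙 Y ≫ inr S X Y) = inr S X Y ≫ 𝟙 _ by simp)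

/-- Equations that hold in a category are closed under derivability. -/
theorem Derives.interp_eq {L : Type w} (ρ : L → 𝓑)
    {E : ∀ ⦃A B : Formula L⦄, Term A B → Term A B → Prop}
    (hE : ∀ ⦃A B : Formula L⦄ (f g : Term A B), E f g → f.interp P S ρ = g.interp P S ρ)
    {A B : Formula L} {f g : Term A B} (h : Derives E f g) :
    f.interp P S ρ = g.interp P S ρ := by
  induction h with
  | extra h => exact hE _ _ h
  | refl => rfl
  | symm _ ih => exact ih.symm
  | trans _ _ ih₁ ih₂ => exact ih₁.trans ih₂
  | comp_congr _ _ ih₁ ih₂ => exact congr_arg₂ (fun a b => a ≫ b) ih₂ ih₁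
  | K₁_congr _ ih => exact congr_arg (fun a => fst P _ _ ≫ a) ih
  | K₂_congr _ ih => exact congr_arg (fun a => snd P _ _ ≫ a) ih
  | pair_congr _ _ ih₁ ih₂ => exact congr_arg₂ (lift P) ih₁ ih₂
  | L₁_congr _ ih => exact congr_arg (fun a => a ≫ inl S _ _) ih
  | L₂_congr _ ih => exact congr_arg (fun a => a ≫ inr S _ _) ih
  | copair_congr _ _ ih₁ ih₂ => exact congr_arg₂ (desc S) ih₁ ih₂
  | id_comp => exact Category.comp_id _
  | comp_id => exact Category.id_comp _
  | assoc => exact Category.assoc _ _ _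
  | comp_K₁ => exact Category.assoc _ _ _
  | comp_K₂ => exact Category.assoc _ _ _
  | K₁_pair => exact lift_fst_assoc P _ _ _
  | K₂_pair => exact lift_snd_assoc P _ _ _
  | pair_comp => exact comp_lift P _ _ _
  | pair_eta => exact lift_eta P _ _
  | L₁_comp => exact (Category.assoc _ _ _).symm
  | L₂_comp => exact (Category.assoc _ _ _).symm
  | copair_L₁ => exact (Category.assoc _ _ _).trans (congr_arg _ (inl_desc S _ _))
  | copair_L₂ => exact (Category.assoc _ _ _).trans (congr_arg _ (inr_desc S _ _))
  | comp_copair => exact desc_comp S _ _ _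
  | copair_eta => exact desc_eta S _ _

theorem Formula.interp_subst {L : Type w} (ρ : L → 𝓑) (s : L → Formula L) (A : Formula L) :
    (A.subst s).interp P S ρ = A.interp P S fun q => (s q).interp P S ρ := by
  induction A with
  | letter p => rfl
  | prod A B ihA ihB => exact congr_arg₂ (fun X Y => (P X Y).cone.pt) ihA ihB
  | sum A B ihA ihB => exact congr_arg₂ (fun X Y => (S X Y).cocone.pt) ihA ihB

/-- The two sides have types that agree only up to the propositional equality
`Formula.interp_subst`, hence `HEq`. The auxiliary facts are congruences along equalities of
objects. -/
theorem Term.interp_subst {L : Type w} (ρ : L → 𝓑) (s : L → Formula L) {A B : Formula L}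
    (f : Term A B) :
    HEq ((f.subst s).interp P S ρ) (f.interp P S fun q => (s q).interp P S ρ) := by
  have comp_heq : ∀ {X X' Y Y' Z Z' : 𝓑} {f : X ⟶ Y} {f' : X' ⟶ Y'} {g : Y ⟶ Z} {g' : Y' ⟶ Z'},
      X = X' → Y = Y' → Z = Z' → HEq f f' → HEq g g' → HEq (f ≫ g) (f' ≫ g') := by
    rintro X _ Y _ Z _ f f' g g' rfl rfl rfl ⟨⟩ ⟨⟩; rfl
  have lift_heq : ∀ {X X' Y Y' Z Z' : 𝓑} {f : Z ⟶ X} {f' : Z' ⟶ X'} {g : Z ⟶ Y} {g' : Z' ⟶ Y'},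
      X = X' → Y = Y' → Z = Z' → HEq f f' → HEq g g' → HEq (lift P f g) (lift P f' g') := by
    rintro X _ Y _ Z _ f f' g g' rfl rfl rfl ⟨⟩ ⟨⟩; rfl
  have desc_heq : ∀ {X X' Y Y' Z Z' : 𝓑} {f : X ⟶ Z} {f' : X' ⟶ Z'} {g : Y ⟶ Z} {g' : Y' ⟶ Z'},
      X = X' → Y = Y' → Z = Z' → HEq f f' → HEq g g' → HEq (desc S f g) (desc S f' g') := by
    rintro X _ Y _ Z _ f f' g g' rfl rfl rfl ⟨⟩ ⟨⟩; rfl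
  have fst_heq : ∀ {X X' Y Y' : 𝓑}, X = X' → Y = Y' → HEq (fst P X Y) (fst P X' Y') := by
    rintro X _ Y _ rfl rfl; rfl
  have snd_heq : ∀ {X X' Y Y' : 𝓑}, X = X' → Y = Y' → HEq (snd P X Y) (snd P X' Y') := by
    rintro X _ Y _ rfl rfl; rfl
  have inl_heq : ∀ {X X' Y Y' : 𝓑}, X = X' → Y = Y' → HEq (inl S X Y) (inl S X' Y') := by
    rintro X _ Y _ rfl rfl; rfl
  have inr_heq : ∀ {X X' Y Y' : 𝓑}, X = X' → Y = Y' → HEq (inr S X Y) (inr S X' Y') := by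
    rintro X _ Y _ rfl rfl; rfl
  have obj := Formula.interp_subst P S ρ s
  induction f with
  | id A => simp only [Term.subst, Term.interp]; rw [obj A]
  | comp g f ihg ihf => exact comp_heq (obj _) (obj _) (obj _) ihf ihg
  | K₁ B f ih =>
    exact comp_heq (obj (.prod _ _)) (obj _) (obj _) (fst_heq (obj _) (obj _)) ih
  | K₂ A f ih =>
    exact comp_heq (obj (.prod _ _)) (obj _) (obj _) (snd_heq (obj _) (obj _)) ih
  | pair f g ihf ihg => exact lift_heq (obj _) (obj _) (obj _) ihf ihg
  | L₁ B f ih =>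
    exact comp_heq (obj _) (obj _) (obj (.sum _ _)) ih (inl_heq (obj _) (obj _))
  | L₂ A f ih =>
    exact comp_heq (obj _) (obj _) (obj (.sum _ _)) ih (inr_heq (obj _) (obj _))
  | copair f g ihf ihg => exact desc_heq (obj _) (obj _) (obj _) ihf ihg

/-- If `f = g` holds in a category, then so does every equation derivable from it. -/
theorem HoldsIn.of_derives {L : Type w} {A B : Formula L} {f g : Term A B}
    (h : HoldsIn P S f g) {A' B' : Formula L} {f' g' : Term A' B'}
    (d : Derives (Instances f g) f' g') : HoldsIn P S f' g' := by
  intro ρ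
  refine d.interp_eq P S ρ ?_
  rintro _ _ _ _ ⟨s⟩
  exact eq_of_heq ((Term.interp_subst P S ρ s f).trans
    ((heq_of_eq (h _)).trans (Term.interp_subst P S ρ s g).symm))

/-- If the first projection of `X × X` factors through the second, then arrows into `X` from
a common source are equal. -/
theorem eq_of_fst_eq_snd_comp {X Z : 𝓑} {e : X ⟶ X} (h : fst P X X = snd P X X ≫ e)
    (a b : Z ⟶ X) : a = b := by
  -- Pair `c` with `a`: the first projection returns `c`, but by `h` it depends on `a` alone.
  have key : ∀ c : Z ⟶ X, c = a ≫ e := fun c => by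
    rw [← lift_fst P c a, h, lift_snd_assoc]
  rw [key a, ← key b]

/-- If the first injection into `X + X` factors through the second, then arrows from `X` to
a common target are equal. -/
theorem eq_of_inl_eq_comp_inr {X Z : 𝓑} {e : X ⟶ X} (h : inl S X X = e ≫ inr S X X)
    (a b : X ⟶ Z) : a = b := by
  have key : ∀ c : X ⟶ Z, c = e ≫ a := fun c => by
    rw [← inl_desc S c a, h, Category.assoc, inr_desc]
  rw [key a, ← key b]

end Soundness

/-! ### Products and sums in the free category -/

namespace Free

variable {L : Type w} {A B C D : Formula L}

/-- The first projection in the free category. -/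
def π₁ (A B : Formula L) : A.prod B ⟶ A := (Term.k₁ A B).arrow

/-- The second projection in the free category. -/
def π₂ (A B : Formula L) : A.prod B ⟶ B := (Term.k₂ A B).arrow

/-- The first injection in the free category. -/
def ι₁ (A B : Formula L) : A ⟶ A.sum B := (Term.l₁ A B).arrow

/-- The second injection in the free category. -/
def ι₂ (A B : Formula L) : B ⟶ A.sum B := (Term.l₂ A B).arrow

/-- Pairing in the free category. -/
def pr (f : C ⟶ A) (g : C ⟶ B) : C ⟶ A.prod B :=
  Quotient.map₂ (sa := freeSetoid C A) (sb := freeSetoid C B) (sc := freeSetoid C (A.prod B))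
    Term.pair (fun _ _ hf _ _ hg => Derives.pair_congr hf hg) f g

/-- Copairing in the free category. -/
def cp (f : A ⟶ C) (g : B ⟶ C) : A.sum B ⟶ C :=
  Quotient.map₂ (sa := freeSetoid A C) (sb := freeSetoid B C) (sc := freeSetoid (A.sum B) C)
    Term.copair (fun _ _ hf _ _ hg => Derives.copair_congr hf hg) f g

theorem exists_arrow_eq (f : A ⟶ B) : ∃ t : Term A B, t.arrow = f :=
  Quotient.exists_rep (s := freeSetoid A B) f

theorem arrow_eq {s t : Term A B} (h : Derives (fun _ _ _ _ => False) s t) :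
    s.arrow = t.arrow :=
  Quotient.sound (s := freeSetoid A B) h

theorem arrow_comp (g : Term B C) (f : Term A B) : (g.comp f).arrow = f.arrow ≫ g.arrow := rfl

theorem arrow_pair (f : Term C A) (g : Term C B) : (f.pair g).arrow = pr f.arrow g.arrow := rfl

theorem arrow_copair (f : Term A C) (g : Term B C) : (f.copair g).arrow = cp f.arrow g.arrow := rfl

theorem arrow_K₁ (f : Term A C) : (f.K₁ B).arrow = π₁ A B ≫ f.arrow :=
  (arrow_eq ((Derives.comp_K₁ f (.id A)).trans (.K₁_congr (.comp_id f)))).symm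

theorem arrow_K₂ (f : Term B C) : (f.K₂ A).arrow = π₂ A B ≫ f.arrow :=
  (arrow_eq ((Derives.comp_K₂ f (.id B)).trans (.K₂_congr (.comp_id f)))).symm

theorem arrow_L₁ (f : Term C A) : (f.L₁ B).arrow = f.arrow ≫ ι₁ A B :=
  (arrow_eq ((Derives.L₁_comp (.id A) f).trans (.L₁_congr (.id_comp f)))).symm

theorem arrow_L₂ (f : Term C B) : (f.L₂ A).arrow = f.arrow ≫ ι₂ A B :=
  (arrow_eq ((Derives.L₂_comp (.id B) f).trans (.L₂_congr (.id_comp f)))).symm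

@[simp]
theorem pr_π₁ (f : C ⟶ A) (g : C ⟶ B) : pr f g ≫ π₁ A B = f := by
  obtain ⟨f, rfl⟩ := exists_arrow_eq f
  obtain ⟨g, rfl⟩ := exists_arrow_eq g
  exact arrow_eq ((Derives.K₁_pair (.id A) f g).trans (.id_comp f))

@[simp]
theorem pr_π₂ (f : C ⟶ A) (g : C ⟶ B) : pr f g ≫ π₂ A B = g := by
  obtain ⟨f, rfl⟩ := exists_arrow_eq f
  obtain ⟨g, rfl⟩ := exists_arrow_eq g
  exact arrow_eq ((Derives.K₂_pair (.id B) f g).trans (.id_comp g))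

@[simp]
theorem pr_π₁_assoc (f : C ⟶ A) (g : C ⟶ B) (h : A ⟶ D) : pr f g ≫ π₁ A B ≫ h = f ≫ h := by
  rw [← Category.assoc, pr_π₁]

@[simp]
theorem pr_π₂_assoc (f : C ⟶ A) (g : C ⟶ B) (h : B ⟶ D) : pr f g ≫ π₂ A B ≫ h = g ≫ h := by
  rw [← Category.assoc, pr_π₂]

theorem comp_pr (h : D ⟶ C) (f : C ⟶ A) (g : C ⟶ B) : h ≫ pr f g = pr (h ≫ f) (h ≫ g) := by
  obtain ⟨f, rfl⟩ := exists_arrow_eq f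
  obtain ⟨g, rfl⟩ := exists_arrow_eq g
  obtain ⟨h, rfl⟩ := exists_arrow_eq h
  exact arrow_eq (Derives.pair_comp f g h)

theorem pr_eta (h : C ⟶ A.prod B) : pr (h ≫ π₁ A B) (h ≫ π₂ A B) = h := by
  have : pr (π₁ A B) (π₂ A B) = 𝟙 _ := arrow_eq (Derives.pair_eta A B)
  rw [← comp_pr, this, Category.comp_id]

theorem prod_ext {f g : C ⟶ A.prod B} (h₁ : f ≫ π₁ A B = g ≫ π₁ A B)
    (h₂ : f ≫ π₂ A B = g ≫ π₂ A B) : f = g := by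
  rw [← pr_eta f, h₁, h₂, pr_eta]

@[simp]
theorem ι₁_cp (f : A ⟶ C) (g : B ⟶ C) : ι₁ A B ≫ cp f g = f := by
  obtain ⟨f, rfl⟩ := exists_arrow_eq f
  obtain ⟨g, rfl⟩ := exists_arrow_eq g
  exact arrow_eq ((Derives.copair_L₁ f g (.id A)).trans (.comp_id f))

@[simp]
theorem ι₂_cp (f : A ⟶ C) (g : B ⟶ C) : ι₂ A B ≫ cp f g = g := by
  obtain ⟨f, rfl⟩ := exists_arrow_eq f
  obtain ⟨g, rfl⟩ := exists_arrow_eq g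
  exact arrow_eq ((Derives.copair_L₂ f g (.id B)).trans (.comp_id g))

theorem cp_comp (f : A ⟶ C) (g : B ⟶ C) (h : C ⟶ D) : cp f g ≫ h = cp (f ≫ h) (g ≫ h) := by
  obtain ⟨f, rfl⟩ := exists_arrow_eq f
  obtain ⟨g, rfl⟩ := exists_arrow_eq g
  obtain ⟨h, rfl⟩ := exists_arrow_eq h
  exact arrow_eq (Derives.comp_copair h f g)

theorem cp_eta (h : A.sum B ⟶ C) : cp (ι₁ A B ≫ h) (ι₂ A B ≫ h) = h := by
  have : cp (ι₁ A B) (ι₂ A B) = 𝟙 _ := arrow_eq (Derives.copair_eta A B)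
  rw [← cp_comp, this, Category.id_comp]

theorem sum_ext {f g : A.sum B ⟶ C} (h₁ : ι₁ A B ≫ f = ι₁ A B ≫ g)
    (h₂ : ι₂ A B ≫ f = ι₂ A B ≫ g) : f = g := by
  rw [← cp_eta f, h₁, h₂, cp_eta]

/-! ### Composition elimination -/

/-- Arrows of the free category denoted by terms without composition in which identities are
restricted to letters. -/
inductive Normal : ∀ {A B : Formula L}, (A ⟶ B) → Prop
  | id (p : L) : Normal (𝟙 (Formula.letter p))
  | K₁ {A C : Formula L} (B : Formula L) {f : A ⟶ C} : Normal f → Normal (π₁ A B ≫ f)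
  | K₂ {B C : Formula L} (A : Formula L) {f : B ⟶ C} : Normal f → Normal (π₂ A B ≫ f)
  | pair {A B C : Formula L} {f : C ⟶ A} {g : C ⟶ B} : Normal f → Normal g → Normal (pr f g)
  | L₁ {A C : Formula L} (B : Formula L) {f : C ⟶ A} : Normal f → Normal (f ≫ ι₁ A B)
  | L₂ {B C : Formula L} (A : Formula L) {f : C ⟶ B} : Normal f → Normal (f ≫ ι₂ A B)
  | copair {A B C : Formula L} {f : A ⟶ C} {g : B ⟶ C} : Normal f → Normal g → Normal (cp f g)

theorem normal_id (A : Formula L) : Normal (𝟙 A) := by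
  induction A with
  | letter p => exact .id p
  | prod A B ihA ihB =>
    rw [← pr_eta (𝟙 (A.prod B)), Category.id_comp, Category.id_comp,
      ← Category.comp_id (π₁ A B), ← Category.comp_id (π₂ A B)]
    exact .pair (.K₁ B ihA) (.K₂ A ihB)
  | sum A B ihA ihB =>
    rw [← cp_eta (𝟙 (A.sum B)), Category.comp_id, Category.comp_id,
      ← Category.id_comp (ι₁ A B), ← Category.id_comp (ι₂ A B)]
    exact .copair (.L₁ B ihA) (.L₂ A ihB)

/-- Induction on `g`: a projection at its start cancels against the pairing, and other operations
are moved outside. The source of `g` is kept as a variable `X` with an equation `e`, so that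
induction over the indexed family applies. The assumptions on `f₁` and `f₂` are the induction
hypotheses of `Normal.comp`. -/
theorem Normal.pr_comp {X : Formula L} {g : X ⟶ C} (hg : Normal g) :
    ∀ {A B : Formula L} (e : A.prod B = X) {f₁ : D ⟶ A} {f₂ : D ⟶ B},
      (∀ {C : Formula L} {g : A ⟶ C}, Normal g → Normal (f₁ ≫ g)) →
      (∀ {C : Formula L} {g : B ⟶ C}, Normal g → Normal (f₂ ≫ g)) →
      Normal (pr f₁ f₂ ≫ eqToHom e ≫ g) := by
  induction hg with
  | id => intro _ _ e; cases e
  | copair => intro _ _ e; cases e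
  | K₁ _ h => rintro _ _ ⟨⟩ _ _ ih₁ ih₂; simpa using ih₁ h
  | K₂ _ h => rintro _ _ ⟨⟩ _ _ ih₁ ih₂; simpa using ih₂ h
  | pair _ _ h₁ h₂ =>
    intro _ _ e _ _ ih₁ ih₂
    rw [comp_pr, comp_pr]
    exact .pair (h₁ e ih₁ ih₂) (h₂ e ih₁ ih₂)
  | L₁ B _ h => intro _ _ e _ _ ih₁ ih₂; simpa using (h e ih₁ ih₂).L₁ B
  | L₂ A _ h => intro _ _ e _ _ ih₁ ih₂; simpa using (h e ih₁ ih₂).L₂ A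

theorem Normal.ι₁_comp {X : Formula L} {g : X ⟶ C} (hg : Normal g) :
    ∀ {A B : Formula L} (e : A.sum B = X) {f : D ⟶ A},
      (∀ {C : Formula L} {g : A ⟶ C}, Normal g → Normal (f ≫ g)) →
      Normal (f ≫ ι₁ A B ≫ eqToHom e ≫ g) := by
  induction hg with
  | id => intro _ _ e; cases e
  | K₁ => intro _ _ e; cases e
  | K₂ => intro _ _ e; cases e
  | copair h => rintro _ _ ⟨⟩ _ ih; simpa using ih h
  | pair _ _ h₁ h₂ =>
    intro _ _ e _ ih
    rw [comp_pr, comp_pr, comp_pr]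
    exact .pair (h₁ e ih) (h₂ e ih)
  | L₁ B _ h => intro _ _ e _ ih; simpa using (h e ih).L₁ B
  | L₂ A _ h => intro _ _ e _ ih; simpa using (h e ih).L₂ A

theorem Normal.ι₂_comp {X : Formula L} {g : X ⟶ C} (hg : Normal g) :
    ∀ {A B : Formula L} (e : A.sum B = X) {f : D ⟶ B},
      (∀ {C : Formula L} {g : B ⟶ C}, Normal g → Normal (f ≫ g)) →
      Normal (f ≫ ι₂ A B ≫ eqToHom e ≫ g) := by
  induction hg with
  | id => intro _ _ e; cases e
  | K₁ => intro _ _ e; cases e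
  | K₂ => intro _ _ e; cases e
  | copair _ h => rintro _ _ ⟨⟩ _ ih; simpa using ih h
  | pair _ _ h₁ h₂ =>
    intro _ _ e _ ih
    rw [comp_pr, comp_pr, comp_pr]
    exact .pair (h₁ e ih) (h₂ e ih)
  | L₁ B _ h => intro _ _ e _ ih; simpa using (h e ih).L₁ B
  | L₂ A _ h => intro _ _ e _ ih; simpa using (h e ih).L₂ A

/-- Composition elimination: normal arrows are closed under composition. -/
theorem Normal.comp {f : A ⟶ B} (hf : Normal f) :
    ∀ {C : Formula L} {g : B ⟶ C}, Normal g → Normal (f ≫ g) := by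
  induction hf with
  | id => intro _ _ hg; simpa using hg
  | K₁ B _ ih => intro _ _ hg; simpa using (ih hg).K₁ B
  | K₂ A _ ih => intro _ _ hg; simpa using (ih hg).K₂ A
  | copair _ _ ih₁ ih₂ => intro _ _ hg; rw [cp_comp]; exact .copair (ih₁ hg) (ih₂ hg)
  | pair _ _ ih₁ ih₂ => intro _ _ hg; simpa using hg.pr_comp rfl ih₁ ih₂
  | L₁ _ _ ih => intro _ _ hg; simpa using hg.ι₁_comp rfl ih
  | L₂ _ _ ih => intro _ _ hg; simpa using hg.ι₂_comp rfl ih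

theorem normal (f : A ⟶ B) : Normal f := by
  obtain ⟨t, rfl⟩ := exists_arrow_eq f
  induction t with
  | id A => exact normal_id A
  | comp g f ihg ihf => exact ihf.comp ihg
  | K₁ B f ih => rw [arrow_K₁]; exact .K₁ B ih
  | K₂ A f ih => rw [arrow_K₂]; exact .K₂ A ih
  | pair f g ihf ihg => exact .pair ihf ihg
  | L₁ B f ih => rw [arrow_L₁]; exact .L₁ B ih
  | L₂ A f ih => rw [arrow_L₂]; exact .L₂ A ih
  | copair f g ihf ihg => exact .copair ihf ihg

/-! ### Shapes of arrows, read off from normal forms -/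

/-- Every normal form other than the identity of a letter has a compound source or target. -/
theorem eq_of_letter_letter {p q : L} (f g : Formula.letter p ⟶ Formula.letter q) : f = g := by
  cases normal f
  cases normal g
  rfl

theorem exists_of_letter_sum {p : L} (f : Formula.letter p ⟶ A.sum B) :
    (∃ f', f = f' ≫ ι₁ A B) ∨ ∃ f', f = f' ≫ ι₂ A B := by
  cases normal f with
  | L₁ => exact .inl ⟨_, rfl⟩
  | L₂ => exact .inr ⟨_, rfl⟩

theorem exists_of_prod_letter {p : L} (f : A.prod B ⟶ Formula.letter p) :
    (∃ f', f = π₁ A B ≫ f') ∨ ∃ f', f = π₂ A B ≫ f' := by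
  cases normal f with
  | K₁ => exact .inl ⟨_, rfl⟩
  | K₂ => exact .inr ⟨_, rfl⟩

theorem exists_of_prod_sum (f : A.prod B ⟶ C.sum D) :
    (∃ f', f = π₁ A B ≫ f') ∨ (∃ f', f = π₂ A B ≫ f') ∨
      (∃ f', f = f' ≫ ι₁ C D) ∨ ∃ f', f = f' ≫ ι₂ C D := by
  cases normal f with
  | K₁ => exact .inl ⟨_, rfl⟩
  | K₂ => exact .inr (.inl ⟨_, rfl⟩)
  | L₁ => exact .inr (.inr (.inl ⟨_, rfl⟩))
  | L₂ => exact .inr (.inr (.inr ⟨_, rfl⟩))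

/-- The arrows `p × p ⟶ p + p` are the composites of a projection and an injection. -/
theorem exists_of_square (p : L)
    (f : (Formula.letter p).prod (.letter p) ⟶ (Formula.letter p).sum (.letter p)) :
    f = π₁ _ _ ≫ ι₁ _ _ ∨ f = π₁ _ _ ≫ ι₂ _ _ ∨ f = π₂ _ _ ≫ ι₁ _ _ ∨ f = π₂ _ _ ≫ ι₂ _ _ := by
  have one : ∀ h : Formula.letter p ⟶ Formula.letter p, h = 𝟙 _ := fun h =>
    eq_of_letter_letter _ _
  have left : ∀ h : Formula.letter p ⟶ (Formula.letter p).sum (.letter p),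
      h = ι₁ _ _ ∨ h = ι₂ _ _ := fun h => by
    rcases exists_of_letter_sum h with ⟨h, rfl⟩ | ⟨h, rfl⟩ <;> simp [one h]
  have right : ∀ h : (Formula.letter p).prod (.letter p) ⟶ Formula.letter p,
      h = π₁ _ _ ∨ h = π₂ _ _ := fun h => by
    rcases exists_of_prod_letter h with ⟨h, rfl⟩ | ⟨h, rfl⟩ <;> simp [one h]
  rcases exists_of_prod_sum f with ⟨h, rfl⟩ | ⟨h, rfl⟩ | ⟨h, rfl⟩ | ⟨h, rfl⟩
  · rcases left h with rfl | rfl <;> simp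
  · rcases left h with rfl | rfl <;> simp
  · rcases right h with rfl | rfl <;> simp
  · rcases right h with rfl | rfl <;> simp

/-! ### Uniform substitution -/

theorem derives_subst (s : L → Formula L) {f g : Term A B}
    (h : Derives (fun _ _ _ _ => False) f g) :
    Derives (fun _ _ _ _ => False) (f.subst s) (g.subst s) := by
  induction h with
  | extra h => exact h.elim
  | refl => exact .refl _
  | symm _ ih => exact ih.symm
  | trans _ _ ih₁ ih₂ => exact ih₁.trans ih₂
  | comp_congr _ _ ih₁ ih₂ => exact .comp_congr ih₁ ih₂
  | K₁_congr _ ih => exact .K₁_congr ih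
  | K₂_congr _ ih => exact .K₂_congr ih
  | pair_congr _ _ ih₁ ih₂ => exact .pair_congr ih₁ ih₂
  | L₁_congr _ ih => exact .L₁_congr ih
  | L₂_congr _ ih => exact .L₂_congr ih
  | copair_congr _ _ ih₁ ih₂ => exact .copair_congr ih₁ ih₂
  | id_comp => exact .id_comp _
  | comp_id => exact .comp_id _
  | assoc => exact .assoc _ _ _
  | comp_K₁ => exact .comp_K₁ _ _
  | comp_K₂ => exact .comp_K₂ _ _
  | K₁_pair => exact .K₁_pair _ _ _
  | K₂_pair => exact .K₂_pair _ _ _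
  | pair_comp => exact .pair_comp _ _ _
  | pair_eta => exact .pair_eta _ _
  | L₁_comp => exact .L₁_comp _ _
  | L₂_comp => exact .L₂_comp _ _
  | copair_L₁ => exact .copair_L₁ _ _ _
  | copair_L₂ => exact .copair_L₂ _ _ _
  | comp_copair => exact .comp_copair _ _ _
  | copair_eta => exact .copair_eta _ _

/-- Uniform substitution on the arrows of the free category. -/
def sub (s : L → Formula L) (f : A ⟶ B) : A.subst s ⟶ B.subst s :=
  Quotient.map (sa := freeSetoid A B) (sb := freeSetoid (A.subst s) (B.subst s))
    (Term.subst s) (fun _ _ => derives_subst s) f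

theorem sub_comp (s : L → Formula L) (f : A ⟶ B) (g : B ⟶ C) :
    sub s (f ≫ g) = sub s f ≫ sub s g := by
  obtain ⟨f, rfl⟩ := exists_arrow_eq f
  obtain ⟨g, rfl⟩ := exists_arrow_eq g
  rfl

/-! ### Occurrences and links -/

/-- Occurrences of letters in a formula. -/
def Occ : Formula L → Type
  | .letter _ => Unit
  | .prod A B => Occ A ⊕ Occ B
  | .sum A B => Occ A ⊕ Occ B

variable (p : L)

/-- The product `p × p`. -/
abbrev sq : Formula L := (Formula.letter p).prod (.letter p)

/-- The sum `p + p`. -/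
abbrev dbl : Formula L := (Formula.letter p).sum (.letter p)

/-- The result of substituting `p` for every letter. -/
abbrev unif (A : Formula L) : Formula L := A.subst fun _ => .letter p

/-- An arrow from `p` to the instance of `A` in which all letters are `p`. -/
def fill : ∀ A : Formula L, Formula.letter p ⟶ unif p A
  | .letter _ => 𝟙 (Formula.letter p)
  | .prod A B => pr (fill A) (fill B)
  | .sum A B => fill A ≫ ι₁ (unif p A) (unif p B)

/-- An arrow to `p` from the instance of `A` in which all letters are `p`. -/
def cofill : ∀ A : Formula L, unif p A ⟶ Formula.letter p
  | .letter _ => 𝟙 (Formula.letter p)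
  | .prod A B => π₁ (unif p A) (unif p B) ≫ cofill A
  | .sum A B => cp (cofill A) (cofill B)

/-- The arrow from `p × p` that feeds the first projection to a single occurrence and the second
projection to the other ones. -/
def test : ∀ A : Formula L, Occ A → (sq p ⟶ unif p A)
  | .letter _, _ => π₁ (.letter p) (.letter p)
  | .prod A B, .inl x => pr (test A x) (π₂ _ _ ≫ fill p B)
  | .prod A B, .inr x => pr (π₂ _ _ ≫ fill p A) (test B x)
  | .sum A B, .inl x => test A x ≫ ι₁ (unif p A) (unif p B)
  | .sum A B, .inr x => test B x ≫ ι₂ (unif p A) (unif p B)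

/-- The arrow to `p + p` that sends a single occurrence to the first summand and the other ones
to the second summand. -/
def cotest : ∀ A : Formula L, Occ A → (unif p A ⟶ dbl p)
  | .letter _, _ => ι₁ (.letter p) (.letter p)
  | .prod A B, .inl x => π₁ (unif p A) (unif p B) ≫ cotest A x
  | .prod A B, .inr x => π₂ (unif p A) (unif p B) ≫ cotest B x
  | .sum A B, .inl x => cp (cotest A x) (cofill p B ≫ ι₂ _ _)
  | .sum A B, .inr x => cp (cofill p A ≫ ι₂ _ _) (cotest B x)

/-- The occurrences `x` and `y` are linked by the arrow `f`. -/
def Linked (f : A ⟶ B) (x : Occ A) (y : Occ B) : Prop :=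
  test p A x ≫ sub _ f ≫ cotest p B y = π₁ _ _ ≫ ι₁ _ _

/-! ### The four arrows `p × p ⟶ p + p`: separating `π₁ ≫ ι₁` from the others -/

theorem interp_eq_of_arrow_eq {𝓑 : Type u} [Category.{v} 𝓑]
    (P : ∀ X Y : 𝓑, LimitCone (Limits.pair X Y)) (S : ∀ X Y : 𝓑, ColimitCocone (Limits.pair X Y))
    (ρ : L → 𝓑) {s t : Term A B} (h : s.arrow = t.arrow) : s.interp P S ρ = t.interp P S ρ :=
  Derives.interp_eq P S ρ (fun _ _ _ _ h => h.elim) (Quotient.exact (s := freeSetoid A B) h)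

/-- Interpret all letters as `Bool` in the category of types: the equality would make the identity
of `Bool` equal to a constant map. -/
theorem π₁_ne_π₂_comp (h : Formula.letter p ⟶ Formula.letter p) : π₁ _ _ ≠ π₂ _ _ ≫ h := by
  obtain ⟨t, rfl⟩ := exists_arrow_eq h
  intro h
  let P : ∀ X Y : Type, LimitCone (Limits.pair X Y) := fun X Y => getLimitCone _
  let S : ∀ X Y : Type, ColimitCocone (Limits.pair X Y) := fun X Y => getColimitCocone _
  have key : fst P Bool Bool = snd P Bool Bool ≫ t.interp P S fun _ => Bool := by
    have := interp_eq_of_arrow_eq P S (fun _ => Bool) (s := Term.k₁ _ _)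
      (t := t.comp (Term.k₂ _ _)) h
    change fst P Bool Bool ≫ 𝟙 _ = (snd P Bool Bool ≫ 𝟙 _) ≫ t.interp P S (fun _ => Bool) at this
    rwa [Category.comp_id, Category.comp_id] at this
  have := eq_of_fst_eq_snd_comp P key (𝟙 Bool) (TypeCat.ofHom fun _ => true)
  simpa using ConcreteCategory.congr_hom this false

theorem ι₁_ne_comp_ι₂ (h : Formula.letter p ⟶ Formula.letter p) : ι₁ _ _ ≠ h ≫ ι₂ _ _ := by
  obtain ⟨t, rfl⟩ := exists_arrow_eq h
  intro h
  let P : ∀ X Y : Type, LimitCone (Limits.pair X Y) := fun X Y => getLimitCone _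
  let S : ∀ X Y : Type, ColimitCocone (Limits.pair X Y) := fun X Y => getColimitCocone _
  have key : inl S Bool Bool = (t.interp P S fun _ => Bool) ≫ inr S Bool Bool := by
    have := interp_eq_of_arrow_eq P S (fun _ => Bool) (s := Term.l₁ _ _)
      (t := (Term.l₂ _ _).comp t) h
    change 𝟙 _ ≫ inl S Bool Bool = t.interp P S (fun _ => Bool) ≫ 𝟙 _ ≫ inr S Bool Bool at this
    have e : 𝟙 Bool ≫ inr S Bool Bool = inr S Bool Bool := Category.id_comp _
    exact ((Category.id_comp _).symm.trans this).trans (congr_arg (_ ≫ ·) e)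
  have := eq_of_inl_eq_comp_inr S key (𝟙 Bool) (TypeCat.ofHom fun _ => true)
  simpa using ConcreteCategory.congr_hom this false

/-- Folding `p + p` onto `p` would make `π₁` factor through `π₂`. -/
theorem π₂_comp_ne (h : Formula.letter p ⟶ dbl p) : π₂ _ _ ≫ h ≠ π₁ _ _ ≫ ι₁ _ _ := by
  intro e
  apply π₁_ne_π₂_comp p (h ≫ cp (𝟙 _) (𝟙 _))
  rw [← Category.assoc, e]
  simp

/-- Precomposing with the diagonal of `p` would make `ι₁` factor through `ι₂`. -/
theorem comp_ι₂_ne (h : sq p ⟶ Formula.letter p) : h ≫ ι₂ _ _ ≠ π₁ _ _ ≫ ι₁ _ _ := by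
  intro e
  apply ι₁_ne_comp_ι₂ p (pr (𝟙 _) (𝟙 _) ≫ h)
  rw [Category.assoc, e]
  simp

/-! ### Links and the operations on arrows -/

variable {p}

theorem linked_π₁_inl {f : A ⟶ C} {x : Occ A} {y : Occ C} :
    Linked p (π₁ A B ≫ f) (.inl x) y ↔ Linked p f x y := by
  unfold Linked
  rw [sub_comp]
  change pr (test p A x) (π₂ _ _ ≫ fill p B) ≫ (π₁ (unif p A) (unif p B) ≫ _) ≫ _ = _ ↔ _
  rw [Category.assoc, pr_π₁_assoc]

theorem linked_π₂_inr {f : B ⟶ C} {x : Occ B} {y : Occ C} :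
    Linked p (π₂ A B ≫ f) (.inr x) y ↔ Linked p f x y := by
  unfold Linked
  rw [sub_comp]
  change pr (π₂ _ _ ≫ fill p A) (test p B x) ≫ (π₂ (unif p A) (unif p B) ≫ _) ≫ _ = _ ↔ _
  rw [Category.assoc, pr_π₂_assoc]

/-- When the tested occurrence lies in the second factor, the first component of `test` is a filling
that starts with `π₂`. The whole composite then factors through `π₂` and cannot be `π₁ ≫ ι₁`. -/
theorem not_linked_π₁_inr {f : A ⟶ C} {x : Occ B} {y : Occ C} :
    ¬Linked p (π₁ A B ≫ f) (.inr x) y := by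
  unfold Linked
  rw [sub_comp]
  change pr (π₂ _ _ ≫ fill p A) (test p B x) ≫ (π₁ (unif p A) (unif p B) ≫ _) ≫ _ ≠ _
  rw [Category.assoc, pr_π₁_assoc, Category.assoc]
  exact π₂_comp_ne p _

theorem not_linked_π₂_inl {f : B ⟶ C} {x : Occ A} {y : Occ C} :
    ¬Linked p (π₂ A B ≫ f) (.inl x) y := by
  unfold Linked
  rw [sub_comp]
  change pr (test p A x) (π₂ _ _ ≫ fill p B) ≫ (π₂ (unif p A) (unif p B) ≫ _) ≫ _ ≠ _
  rw [Category.assoc, pr_π₂_assoc, Category.assoc]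
  exact π₂_comp_ne p _

theorem linked_ι₁_inl {f : C ⟶ A} {x : Occ C} {y : Occ A} :
    Linked p (f ≫ ι₁ A B) x (.inl y) ↔ Linked p f x y := by
  unfold Linked
  rw [sub_comp]
  change _ ≫ (_ ≫ ι₁ (unif p A) (unif p B)) ≫ cp (cotest p A y) (cofill p B ≫ ι₂ _ _) = _ ↔ _
  rw [Category.assoc, ι₁_cp]

theorem linked_ι₂_inr {f : C ⟶ B} {x : Occ C} {y : Occ B} :
    Linked p (f ≫ ι₂ A B) x (.inr y) ↔ Linked p f x y := by
  unfold Linked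
  rw [sub_comp]
  change _ ≫ (_ ≫ ι₂ (unif p A) (unif p B)) ≫ cp (cofill p A ≫ ι₂ _ _) (cotest p B y) = _ ↔ _
  rw [Category.assoc, ι₂_cp]

theorem not_linked_ι₁_inr {f : C ⟶ A} {x : Occ C} {y : Occ B} :
    ¬Linked p (f ≫ ι₁ A B) x (.inr y) := by
  unfold Linked
  rw [sub_comp]
  change _ ≫ (_ ≫ ι₁ (unif p A) (unif p B)) ≫ cp (cofill p A ≫ ι₂ _ _) (cotest p B y) ≠ _
  rw [Category.assoc, ι₁_cp, ← Category.assoc, ← Category.assoc]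
  exact comp_ι₂_ne p _

theorem not_linked_ι₂_inl {f : C ⟶ B} {x : Occ C} {y : Occ A} :
    ¬Linked p (f ≫ ι₂ A B) x (.inl y) := by
  unfold Linked
  rw [sub_comp]
  change _ ≫ (_ ≫ ι₂ (unif p A) (unif p B)) ≫ cp (cotest p A y) (cofill p B ≫ ι₂ _ _) ≠ _
  rw [Category.assoc, ι₂_cp, ← Category.assoc, ← Category.assoc]
  exact comp_ι₂_ne p _

/-- `cotest` at an occurrence in a product begins with the matching projection, so both sides are
the same composite up to associativity. -/
theorem linked_comp_π₁ {f : C ⟶ A.prod B} {x : Occ C} {y : Occ A} :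
    Linked p (f ≫ π₁ A B) x y ↔ Linked p f x (.inl y) := by
  unfold Linked
  rw [sub_comp, Category.assoc]
  rfl

theorem linked_comp_π₂ {f : C ⟶ A.prod B} {x : Occ C} {y : Occ B} :
    Linked p (f ≫ π₂ A B) x y ↔ Linked p f x (.inr y) := by
  unfold Linked
  rw [sub_comp, Category.assoc]
  rfl

theorem linked_ι₁_comp {f : A.sum B ⟶ C} {x : Occ A} {y : Occ C} :
    Linked p (ι₁ A B ≫ f) x y ↔ Linked p f (.inl x) y := by
  unfold Linked
  rw [sub_comp, Category.assoc, ← Category.assoc]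
  rfl

theorem linked_ι₂_comp {f : A.sum B ⟶ C} {x : Occ B} {y : Occ C} :
    Linked p (ι₂ A B ≫ f) x y ↔ Linked p f (.inr x) y := by
  unfold Linked
  rw [sub_comp, Category.assoc, ← Category.assoc]
  rfl

variable (p) in
-- A link persists through each operation on normal forms; for a pairing or copairing, one component
-- suffices.
theorem exists_linked (f : A ⟶ B) : ∃ x y, Linked p f x y := by
  induction normal f with
  | id q =>
    refine ⟨(), (), ?_⟩
    change π₁ (.letter p) (.letter p) ≫ 𝟙 (Formula.letter p) ≫ ι₁ _ _ = _
    rw [Category.id_comp]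
  | K₁ B _ ih => obtain ⟨x, y, h⟩ := ih; exact ⟨.inl x, y, linked_π₁_inl.2 h⟩
  | K₂ A _ ih => obtain ⟨x, y, h⟩ := ih; exact ⟨.inr x, y, linked_π₂_inr.2 h⟩
  | L₁ B _ ih => obtain ⟨x, y, h⟩ := ih; exact ⟨x, .inl y, linked_ι₁_inl.2 h⟩
  | L₂ A _ ih => obtain ⟨x, y, h⟩ := ih; exact ⟨x, .inr y, linked_ι₂_inr.2 h⟩
  | pair _ _ ih _ =>
    obtain ⟨x, y, h⟩ := ih
    exact ⟨x, .inl y, linked_comp_π₁.1 (by rwa [pr_π₁])⟩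
  | copair _ _ ih _ =>
    obtain ⟨x, y, h⟩ := ih
    exact ⟨.inl x, y, linked_ι₁_comp.1 (by rwa [ι₁_cp])⟩

/-! ### Absence of links forces a factorization -/

/-- An arrow that links no occurrence of the second factor factors through the first
projection. -/
theorem exists_eq_π₁_comp (f : A.prod B ⟶ C) (hf : ∀ x y, ¬Linked p f (.inr x) y) :
    ∃ f', f = π₁ A B ≫ f' := by
  induction C with
  | letter q =>
    rcases exists_of_prod_letter f with h | ⟨f, rfl⟩
    · exact h
    -- Factoring through the wrong projection is impossible: the remaining arrow links something,
    -- which would be a forbidden link.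
    · obtain ⟨x, y, h⟩ := exists_linked p f
      exact (hf x y (linked_π₂_inr.2 h)).elim
  | prod C D ihC ihD =>
    obtain ⟨f₁, h₁⟩ := ihC (f ≫ π₁ C D) fun x y h => hf x (.inl y) (linked_comp_π₁.1 h)
    obtain ⟨f₂, h₂⟩ := ihD (f ≫ π₂ C D) fun x y h => hf x (.inr y) (linked_comp_π₂.1 h)
    exact ⟨pr f₁ f₂, by rw [← pr_eta f, h₁, h₂, comp_pr]⟩
  | sum C D ihC ihD =>
    rcases exists_of_prod_sum f with h | ⟨f, rfl⟩ | ⟨f, rfl⟩ | ⟨f, rfl⟩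
    · exact h
    · obtain ⟨x, y, h⟩ := exists_linked p f
      exact (hf x y (linked_π₂_inr.2 h)).elim
    · obtain ⟨f', rfl⟩ := ihC f fun x y h => hf x (.inl y) (linked_ι₁_inl.2 h)
      exact ⟨f' ≫ ι₁ C D, Category.assoc _ _ _⟩
    · obtain ⟨f', rfl⟩ := ihD f fun x y h => hf x (.inr y) (linked_ι₂_inr.2 h)
      exact ⟨f' ≫ ι₂ C D, Category.assoc _ _ _⟩

/-- An arrow that links no occurrence of the first factor factors through the second
projection. -/
theorem exists_eq_π₂_comp (f : A.prod B ⟶ C) (hf : ∀ x y, ¬Linked p f (.inl x) y) :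
    ∃ f', f = π₂ A B ≫ f' := by
  induction C with
  | letter q =>
    rcases exists_of_prod_letter f with ⟨f, rfl⟩ | h
    · obtain ⟨x, y, h⟩ := exists_linked p f
      exact (hf x y (linked_π₁_inl.2 h)).elim
    · exact h
  | prod C D ihC ihD =>
    obtain ⟨f₁, h₁⟩ := ihC (f ≫ π₁ C D) fun x y h => hf x (.inl y) (linked_comp_π₁.1 h)
    obtain ⟨f₂, h₂⟩ := ihD (f ≫ π₂ C D) fun x y h => hf x (.inr y) (linked_comp_π₂.1 h)
    exact ⟨pr f₁ f₂, by rw [← pr_eta f, h₁, h₂, comp_pr]⟩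
  | sum C D ihC ihD =>
    rcases exists_of_prod_sum f with ⟨f, rfl⟩ | h | ⟨f, rfl⟩ | ⟨f, rfl⟩
    · obtain ⟨x, y, h⟩ := exists_linked p f
      exact (hf x y (linked_π₁_inl.2 h)).elim
    · exact h
    · obtain ⟨f', rfl⟩ := ihC f fun x y h => hf x (.inl y) (linked_ι₁_inl.2 h)
      exact ⟨f' ≫ ι₁ C D, Category.assoc _ _ _⟩
    · obtain ⟨f', rfl⟩ := ihD f fun x y h => hf x (.inr y) (linked_ι₂_inr.2 h)
      exact ⟨f' ≫ ι₂ C D, Category.assoc _ _ _⟩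

/-- An arrow that links no occurrence of the second summand factors through the first
injection. -/
theorem exists_eq_comp_ι₁ (f : C ⟶ A.sum B) (hf : ∀ x y, ¬Linked p f x (.inr y)) :
    ∃ f', f = f' ≫ ι₁ A B := by
  induction C with
  | letter q =>
    rcases exists_of_letter_sum f with h | ⟨f, rfl⟩
    · exact h
    · obtain ⟨x, y, h⟩ := exists_linked p f
      exact (hf x y (linked_ι₂_inr.2 h)).elim
  | sum C D ihC ihD =>
    obtain ⟨f₁, h₁⟩ := ihC (ι₁ C D ≫ f) fun x y h => hf (.inl x) y (linked_ι₁_comp.1 h)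
    obtain ⟨f₂, h₂⟩ := ihD (ι₂ C D ≫ f) fun x y h => hf (.inr x) y (linked_ι₂_comp.1 h)
    exact ⟨cp f₁ f₂, by rw [← cp_eta f, h₁, h₂, cp_comp]⟩
  | prod C D ihC ihD =>
    rcases exists_of_prod_sum f with ⟨f, rfl⟩ | ⟨f, rfl⟩ | h | ⟨f, rfl⟩
    · obtain ⟨f', rfl⟩ := ihC f fun x y h => hf (.inl x) y (linked_π₁_inl.2 h)
      exact ⟨π₁ C D ≫ f', (Category.assoc _ _ _).symm⟩
    · obtain ⟨f', rfl⟩ := ihD f fun x y h => hf (.inr x) y (linked_π₂_inr.2 h)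
      exact ⟨π₂ C D ≫ f', (Category.assoc _ _ _).symm⟩
    · exact h
    · obtain ⟨x, y, h⟩ := exists_linked p f
      exact (hf x y (linked_ι₂_inr.2 h)).elim

/-- An arrow that links no occurrence of the first summand factors through the second
injection. -/
theorem exists_eq_comp_ι₂ (f : C ⟶ A.sum B) (hf : ∀ x y, ¬Linked p f x (.inl y)) :
    ∃ f', f = f' ≫ ι₂ A B := by
  induction C with
  | letter q =>
    rcases exists_of_letter_sum f with ⟨f, rfl⟩ | h
    · obtain ⟨x, y, h⟩ := exists_linked p f
      exact (hf x y (linked_ι₁_inl.2 h)).elim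
    · exact h
  | sum C D ihC ihD =>
    obtain ⟨f₁, h₁⟩ := ihC (ι₁ C D ≫ f) fun x y h => hf (.inl x) y (linked_ι₁_comp.1 h)
    obtain ⟨f₂, h₂⟩ := ihD (ι₂ C D ≫ f) fun x y h => hf (.inr x) y (linked_ι₂_comp.1 h)
    exact ⟨cp f₁ f₂, by rw [← cp_eta f, h₁, h₂, cp_comp]⟩
  | prod C D ihC ihD =>
    rcases exists_of_prod_sum f with ⟨f, rfl⟩ | ⟨f, rfl⟩ | ⟨f, rfl⟩ | h
    · obtain ⟨f', rfl⟩ := ihC f fun x y h => hf (.inl x) y (linked_π₁_inl.2 h)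
      exact ⟨π₁ C D ≫ f', (Category.assoc _ _ _).symm⟩
    · obtain ⟨f', rfl⟩ := ihD f fun x y h => hf (.inr x) y (linked_π₂_inr.2 h)
      exact ⟨π₂ C D ≫ f', (Category.assoc _ _ _).symm⟩
    · obtain ⟨x, y, h⟩ := exists_linked p f
      exact (hf x y (linked_ι₁_inl.2 h)).elim
    · exact h

/-! ### Coherence -/

/-- Coherence: arrows of the free category that link the same occurrences are equal. -/
theorem eq_of_linked_iff {f g : A ⟶ B} (h : ∀ x y, Linked p f x y ↔ Linked p g x y) :
    f = g := by
  induction A generalizing B with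
  | sum A₁ A₂ ih₁ ih₂ =>
    apply sum_ext
    · exact ih₁ fun _ _ => linked_ι₁_comp.trans ((h _ _).trans linked_ι₁_comp.symm)
    · exact ih₂ fun _ _ => linked_ι₂_comp.trans ((h _ _).trans linked_ι₂_comp.symm)
  | letter q =>
    induction B with
    | letter r => exact eq_of_letter_letter f g
    | prod B₁ B₂ ih₁ ih₂ =>
      apply prod_ext
      · exact ih₁ fun _ _ => linked_comp_π₁.trans ((h _ _).trans linked_comp_π₁.symm)
      · exact ih₂ fun _ _ => linked_comp_π₂.trans ((h _ _).trans linked_comp_π₂.symm)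
    | sum B₁ B₂ ih₁ ih₂ =>
      rcases exists_of_letter_sum f with ⟨f, rfl⟩ | ⟨f, rfl⟩
      -- No occurrence of the second summand is linked by `f ≫ ι₁`, hence none by `g`, so `g` ends
      -- with the same injection, which can be stripped from both.
      · obtain ⟨g, rfl⟩ := exists_eq_comp_ι₁ g fun x y hg => not_linked_ι₁_inr ((h _ _).2 hg)
        exact congr_arg (· ≫ ι₁ _ _)
          (ih₁ fun _ _ => linked_ι₁_inl.symm.trans ((h _ _).trans linked_ι₁_inl))
      · obtain ⟨g, rfl⟩ := exists_eq_comp_ι₂ g fun x y hg => not_linked_ι₂_inl ((h _ _).2 hg)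
        exact congr_arg (· ≫ ι₂ _ _)
          (ih₂ fun _ _ => linked_ι₂_inr.symm.trans ((h _ _).trans linked_ι₂_inr))
  | prod A₁ A₂ ihA₁ ihA₂ =>
    -- Stripping a common first projection works for any target, so this serves both the letter and
    -- the sum cases below.
    have of_π₁ : ∀ {B : Formula L} {f : A₁ ⟶ B} {g : A₁.prod A₂ ⟶ B},
        (∀ x y, Linked p (π₁ A₁ A₂ ≫ f) x y ↔ Linked p g x y) → π₁ A₁ A₂ ≫ f = g := by
      intro B f g h
      obtain ⟨g, rfl⟩ := exists_eq_π₁_comp g fun x y hg => not_linked_π₁_inr ((h _ _).2 hg)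
      exact congr_arg (π₁ _ _ ≫ ·)
          (ihA₁ fun _ _ => linked_π₁_inl.symm.trans ((h _ _).trans linked_π₁_inl))
    have of_π₂ : ∀ {B : Formula L} {f : A₂ ⟶ B} {g : A₁.prod A₂ ⟶ B},
        (∀ x y, Linked p (π₂ A₁ A₂ ≫ f) x y ↔ Linked p g x y) → π₂ A₁ A₂ ≫ f = g := by
      intro B f g h
      obtain ⟨g, rfl⟩ := exists_eq_π₂_comp g fun x y hg => not_linked_π₂_inl ((h _ _).2 hg)
      exact congr_arg (π₂ _ _ ≫ ·)
          (ihA₂ fun _ _ => linked_π₂_inr.symm.trans ((h _ _).trans linked_π₂_inr))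
    induction B with
    | letter r =>
      rcases exists_of_prod_letter f with ⟨f, rfl⟩ | ⟨f, rfl⟩
      · exact of_π₁ h
      · exact of_π₂ h
    | prod B₁ B₂ ih₁ ih₂ =>
      apply prod_ext
      · exact ih₁ fun _ _ => linked_comp_π₁.trans ((h _ _).trans linked_comp_π₁.symm)
      · exact ih₂ fun _ _ => linked_comp_π₂.trans ((h _ _).trans linked_comp_π₂.symm)
    | sum B₁ B₂ ih₁ ih₂ =>
      rcases exists_of_prod_sum f with ⟨f, rfl⟩ | ⟨f, rfl⟩ | ⟨f, rfl⟩ | ⟨f, rfl⟩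
      · exact of_π₁ h
      · exact of_π₂ h
      · obtain ⟨g, rfl⟩ := exists_eq_comp_ι₁ g fun x y hg => not_linked_ι₁_inr ((h _ _).2 hg)
        exact congr_arg (· ≫ ι₁ _ _)
          (ih₁ fun _ _ => linked_ι₁_inl.symm.trans ((h _ _).trans linked_ι₁_inl))
      · obtain ⟨g, rfl⟩ := exists_eq_comp_ι₂ g fun x y hg => not_linked_ι₂_inl ((h _ _).2 hg)
        exact congr_arg (· ≫ ι₂ _ _)
          (ih₂ fun _ _ => linked_ι₂_inr.symm.trans ((h _ _).trans linked_ι₂_inr))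

/-! ### From distinct arrows to equal projections or injections -/

/-- Extra equations only enlarge derivability. Computations with arrows of the free category can
thus be inserted in derivations from `E`. -/
theorem derives_of_arrow_eq {E : ∀ ⦃A B : Formula L⦄, Term A B → Term A B → Prop}
    {s t : Term A B} (h : s.arrow = t.arrow) : Derives E s t := by
  replace h : Derives (fun _ _ _ _ => False) s t := Quotient.exact (s := freeSetoid A B) h
  induction h with
  | extra h => exact h.elim
  | refl => exact .refl _
  | symm _ ih => exact ih.symm
  | trans _ _ ih₁ ih₂ => exact ih₁.trans ih₂
  | comp_congr _ _ ih₁ ih₂ => exact .comp_congr ih₁ ih₂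
  | K₁_congr _ ih => exact .K₁_congr ih
  | K₂_congr _ ih => exact .K₂_congr ih
  | pair_congr _ _ ih₁ ih₂ => exact .pair_congr ih₁ ih₂
  | L₁_congr _ ih => exact .L₁_congr ih
  | L₂_congr _ ih => exact .L₂_congr ih
  | copair_congr _ _ ih₁ ih₂ => exact .copair_congr ih₁ ih₂
  | id_comp => exact .id_comp _
  | comp_id => exact .comp_id _
  | assoc => exact .assoc _ _ _
  | comp_K₁ => exact .comp_K₁ _ _
  | comp_K₂ => exact .comp_K₂ _ _
  | K₁_pair => exact .K₁_pair _ _ _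
  | K₂_pair => exact .K₂_pair _ _ _
  | pair_comp => exact .pair_comp _ _ _
  | pair_eta => exact .pair_eta _ _
  | L₁_comp => exact .L₁_comp _ _
  | L₂_comp => exact .L₂_comp _ _
  | copair_L₁ => exact .copair_L₁ _ _ _
  | copair_L₂ => exact .copair_L₂ _ _ _
  | comp_copair => exact .comp_copair _ _ _
  | copair_eta => exact .copair_eta _ _

/-- If `l¹ ∘ k¹` is provably equal to some different arrow `p × p ⟶ p + p`, then the two
projections or the two injections are provably equal. -/
theorem derives_of_square {E : ∀ ⦃A B : Formula L⦄, Term A B → Term A B → Prop}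
    {s t : Term (sq p) (dbl p)} (d : Derives E s t) (hs : s.arrow = π₁ _ _ ≫ ι₁ _ _)
    (ht : t.arrow ≠ π₁ _ _ ≫ ι₁ _ _) :
    Derives E (Term.k₁ (.letter p) (.letter p)) (Term.k₂ (.letter p) (.letter p)) ∨
      Derives E (Term.l₁ (.letter p) (.letter p)) (Term.l₂ (.letter p) (.letter p)) := by
  let i : Term (Formula.letter p) (.letter p) := .id _
  -- The diagonal cancels either projection and leaves an injection; the folding map below cancels
  -- either injection and leaves a projection.
  have pre : Derives E (s.comp (i.pair i)) (t.comp (i.pair i)) := .comp_congr d (.refl _)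
  have post : Derives E ((i.copair i).comp s) ((i.copair i).comp t) := .comp_congr (.refl _) d
  have hi : i.arrow = 𝟙 _ := rfl
  rcases exists_of_square p t.arrow with h | h | h | h
  · exact (ht h).elim
  · refine .inr (((derives_of_arrow_eq ?_).trans pre).trans (derives_of_arrow_eq ?_))
    · rw [arrow_comp, arrow_pair, hs, hi, pr_π₁_assoc, Category.id_comp]; rfl
    · rw [arrow_comp, arrow_pair, h, hi, pr_π₁_assoc, Category.id_comp]; rfl
  · refine .inl (((derives_of_arrow_eq ?_).trans post).trans (derives_of_arrow_eq ?_))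
    · rw [arrow_comp, arrow_copair, hs, hi, Category.assoc, ι₁_cp, Category.comp_id]; rfl
    · rw [arrow_comp, arrow_copair, h, hi, Category.assoc, ι₁_cp, Category.comp_id]; rfl
  -- Here `t` differs from `s` in both projection and injection, so `pre` and `post` would each do.
  · refine .inr (((derives_of_arrow_eq ?_).trans pre).trans (derives_of_arrow_eq ?_))
    · rw [arrow_comp, arrow_pair, hs, hi, pr_π₁_assoc, Category.id_comp]; rfl
    · rw [arrow_comp, arrow_pair, h, hi, pr_π₂_assoc, Category.id_comp]; rfl

end Free

/-- There are no constant formulae. This supplies a letter for the preorder claim, which names none.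
-/
theorem Formula.nonempty_letters {L : Type w} (A : Formula L) : Nonempty L := by
  induction A with
  | letter p => exact ⟨p⟩
  | prod _ _ ih _ => exact ih
  | sum _ _ ih _ => exact ih

/-- An underivable equation makes two projections or two injections equal. -/
theorem derives_projections_or_injections {L : Type w} {A B : Formula L} {f g : Term A B}
    (hfg : f.arrow ≠ g.arrow) (p : L) :
    Derives (Instances f g) (Term.k₁ (.letter p) (.letter p)) (Term.k₂ (.letter p) (.letter p)) ∨
      Derives (Instances f g) (Term.l₁ (.letter p) (.letter p))
        (Term.l₂ (.letter p) (.letter p)) := by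
  obtain ⟨x, y, hxy⟩ : ∃ x y, ¬(Free.Linked p f.arrow x y ↔ Free.Linked p g.arrow x y) := by
    by_contra! h
    exact hfg (Free.eq_of_linked_iff h)
  obtain ⟨a, ha⟩ := Free.exists_arrow_eq (Free.test p A x)
  obtain ⟨b, hb⟩ := Free.exists_arrow_eq (Free.cotest p B y)
  let context : Term A B → Term (Free.sq p) (Free.dbl p) := fun t =>
    (b.comp (t.subst fun _ => .letter p)).comp a
  have linked_iff : ∀ t : Term A B, Free.Linked p t.arrow x y ↔
      (context t).arrow = Free.π₁ _ _ ≫ Free.ι₁ _ _ := fun t => by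
    rw [Free.Linked, ← ha, ← hb]
    rfl
  have d : Derives (Instances f g) (context f) (context g) :=
    .comp_congr (.comp_congr (.refl b) (.extra (.mk _))) (.refl a)
  rw [linked_iff, linked_iff] at hxy
  by_cases hf : (context f).arrow = Free.π₁ _ _ ≫ Free.ι₁ _ _
  · exact Free.derives_of_square d hf fun hg => hxy (iff_of_true hf hg)
  -- The contexts disagree on being `π₁ ≫ ι₁`, so in this case it is `context g` that has this
  -- value.
  · exact Free.derives_of_square d.symm (by_contra fun hg => hxy (iff_of_false hf hg)) hf

end ProdSum

theorem mainTheorem2 {L : Type w} {A B : ProdSum.Formula L} (f g : ProdSum.Term A B)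
    (hfg : f.arrow ≠ g.arrow) :
    (∀ (𝓑 : Type u) [Category.{v} 𝓑] (P : ∀ X Y : 𝓑, LimitCone (Limits.pair X Y))
      (S : ∀ X Y : 𝓑, ColimitCocone (Limits.pair X Y)),
      ProdSum.HoldsIn P S f g → Quiver.IsThin 𝓑) ∧
    (∀ p : L,
      ProdSum.Derives (ProdSum.Instances f g)
          (ProdSum.Term.k₁ (.letter p) (.letter p)) (ProdSum.Term.k₂ (.letter p) (.letter p)) ∨
      ProdSum.Derives (ProdSum.Instances f g)
          (ProdSum.Term.l₁ (.letter p) (.letter p)) (ProdSum.Term.l₂ (.letter p) (.letter p))) := by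
  refine ⟨fun 𝓑 _ P S h X Y => ⟨fun a b => ?_⟩,
    ProdSum.derives_projections_or_injections hfg⟩
  obtain ⟨p⟩ := A.nonempty_letters
  rcases ProdSum.derives_projections_or_injections hfg p with d | d
  -- Equal projections constrain arrows by their target, so the letters are sent to `Y`; equal
  -- injections constrain them by their source, so below they are sent to `X`.
  · have e : ProdSum.fst P Y Y ≫ 𝟙 Y = ProdSum.snd P Y Y ≫ 𝟙 Y := h.of_derives P S d fun _ => Y
    rw [Category.comp_id] at e
    exact ProdSum.eq_of_fst_eq_snd_comp P e a b
  · have e : 𝟙 X ≫ ProdSum.inl S X X = 𝟙 X ≫ ProdSum.inr S X X := h.of_derives P S d fun _ => X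
    rw [Category.id_comp] at e
    exact ProdSum.eq_of_inl_eq_comp_inr S e a b
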